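/- Let $F$ be a field, let $a_0, a_1, \ldots$ and $b_0, b_1, \ldots$ be two sequences of (algebraically independent) indeterminates over $F$, and let $R = F[a_0, a_1, \ldots, b_0, b_1, \ldots]$ be the polynomial ring in all of them. For a power series $h \in R[[X]]$, let the content $c(h)$ be the ideal of $R$ generated by the coefficients of $h$. Let $f = \sum_{i=0}^\infty a_i X^i$ and $g = \sum_{i=0}^\infty b_i X^i$ in $R[[X]]$. Then $R$ is not Noetherian, and there is no integer $k \ge 1$ such that \[ c(f)^k\, c(g) = c(f)^{k-1}\, c(fg). \] -/

import Mathlib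

/-- The content `c(h)` of a power series `h` over `R`: the ideal of `R` generated by the
coefficients of `h`. -/
def PowerSeries.contentIdeal {R : Type*} [CommRing R] (h : PowerSeries R) : Ideal R :=
  Ideal.span (Set.range fun n : ℕ => PowerSeries.coeff n h)

/-- The polynomial ring `F[a₀, a₁, …, b₀, b₁, …]` in two sequences of indeterminates. -/
abbrev TwoSeqRing (F : Type*) [Field F] : Type _ := MvPolynomial (ℕ ⊕ ℕ) F

/-- The indeterminate `aᵢ`. -/
noncomputable def TwoSeqRing.a (F : Type*) [Field F] (i : ℕ) : TwoSeqRing F :=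
  MvPolynomial.X (Sum.inl i)

/-- The indeterminate `bᵢ`. -/
noncomputable def TwoSeqRing.b (F : Type*) [Field F] (i : ℕ) : TwoSeqRing F :=
  MvPolynomial.X (Sum.inr i)

/-- The generic power series `f = ∑ aᵢ Xⁱ`. -/
noncomputable def genericF (F : Type*) [Field F] : PowerSeries (TwoSeqRing F) :=
  PowerSeries.mk (TwoSeqRing.a F)

/-- The generic power series `g = ∑ bᵢ Xⁱ`. -/
noncomputable def genericG (F : Type*) [Field F] : PowerSeries (TwoSeqRing F) :=
  PowerSeries.mk (TwoSeqRing.b F)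

/-! Equality for some `k` would put `a₀ ^ k * b_k`, a member of the left side, into `c(fg)`.
Specialize `f` to `x + yX` and `g` to the alternating sum for which the product telescopes to `x ^
(k + 1) ± y ^ (k + 1) X ^ (k + 1)`. Then `c(fg)` lands in `(x ^ (k + 1), y ^ (k + 1))`, but `a₀ ^ k
* b_k` becomes `± x ^ k * y ^ k`, which is outside. -/

/-- Over a nontrivial ring, a polynomial ring in infinitely many variables is not Noetherian. -/
theorem MvPolynomial.not_isNoetherianRing {σ R : Type*} [CommRing R] [Nontrivial R] [Infinite σ] :
    ¬ IsNoetherianRing (MvPolynomial σ R) := by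
  classical
  intro h
  obtain ⟨s, hs⟩ := (isNoetherianRing_iff_ideal_fg _).1 h
    (Ideal.span (Set.range (MvPolynomial.X : σ → MvPolynomial σ R)))
  obtain ⟨i, hi⟩ := Infinite.exists_notMem_finset (s.biUnion MvPolynomial.vars)
  have hX : (MvPolynomial.X i : MvPolynomial σ R) ∈ Ideal.span (s : Set (MvPolynomial σ R)) := by
    rw [hs]
    exact Ideal.subset_span ⟨i, rfl⟩
  -- No generator involves `X i`, so each takes the same value here as at the origin, namely `0`;
  -- but `X i` takes the value `1`.
  let φ : MvPolynomial σ R →ₐ[R] R := MvPolynomial.aeval (Pi.single i 1)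
  have hle : Ideal.span (s : Set (MvPolynomial σ R)) ≤ RingHom.ker φ := by
    refine Ideal.span_le.2 fun p hp => ?_
    have hp0 : p ∈ RingHom.ker (MvPolynomial.aeval (fun _ => (0 : R)) :
        MvPolynomial σ R →ₐ[R] R) := by
      have : p ∈ Ideal.span (s : Set (MvPolynomial σ R)) := Ideal.subset_span hp
      rw [hs] at this
      refine (Ideal.span_le.2 ?_) this
      rintro _ ⟨j, rfl⟩
      simp
    change φ p = 0
    rw [← (RingHom.mem_ker.1 hp0 : _ = (0 : R))]
    refine MvPolynomial.eval₂Hom_congr' rfl (fun j hj _ => ?_) rfl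
    have : j ≠ i := by
      rintro rfl
      exact hi (Finset.mem_biUnion.2 ⟨p, hp, hj⟩)
    simp [this]
  have := RingHom.mem_ker.1 (hle hX)
  simp [φ] at this

/-- The monomial `x ^ k * y ^ k` does not lie in the ideal `(x ^ (k + 1), y ^ (k + 1))`. -/
theorem MvPolynomial.X_pow_mul_X_pow_notMem {R : Type*} [CommRing R] [Nontrivial R] (k : ℕ) :
    (X 0 ^ k * X 1 ^ k : MvPolynomial (Fin 2) R) ∉
      Ideal.span {X 0 ^ (k + 1), X 1 ^ (k + 1)} := by
  classical
  intro h
  obtain ⟨p, q, hpq⟩ := Ideal.mem_span_pair.1 h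
  have hc := congrArg (coeff (Finsupp.single 0 k + Finsupp.single 1 k)) hpq
  -- Neither generator divides `x ^ k * y ^ k`, so its coefficient gives `0 = 1`.
  simp [X_pow_eq_monomial, coeff_mul_monomial', monomial_mul, Finsupp.le_def,
    Fin.forall_fin_two] at hc

/-- A product of a linear series `x + y X` with the homogeneous series
`∑ (-1) ^ s * x ^ (k - s) * y ^ s X ^ s` has only the coefficients `x ^ (k + 1)` and
`± y ^ (k + 1)`. -/
theorem PowerSeries.coeff_linear_mul_alternating_mem {S : Type*} [CommRing S] (x y : S) (k n : ℕ) :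
    coeff n ((C x + X * C y) *
      mk fun s => if s ≤ k then (-1) ^ s * x ^ (k - s) * y ^ s else 0) ∈
      Ideal.span {x ^ (k + 1), y ^ (k + 1)} := by
  have hx : x ^ (k + 1) ∈ Ideal.span {x ^ (k + 1), y ^ (k + 1)} :=
    Ideal.subset_span (by simp)
  have hy : y ^ (k + 1) ∈ Ideal.span {x ^ (k + 1), y ^ (k + 1)} :=
    Ideal.subset_span (by simp)
  rw [add_mul, mul_assoc, map_add, coeff_C_mul]
  cases n with
  | zero =>
    simpa [← pow_succ'] using hx
  | succ n =>
    rw [coeff_succ_X_mul, coeff_C_mul, coeff_mk, coeff_mk]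
    rcases lt_trichotomy n k with h | rfl | h
    · rw [if_pos (by omega), if_pos h.le]
      obtain ⟨d, rfl⟩ := Nat.exists_eq_add_of_lt h
      rw [show n + d + 1 - (n + 1) = d by omega, show n + d + 1 - n = d + 1 by omega]
      -- Consecutive terms cancel by the alternating sign.
      convert Ideal.zero_mem _ using 1
      ring
    · rw [if_neg (by omega), if_pos le_rfl]
      convert Ideal.mul_mem_left _ ((-1) ^ n) hy using 1
      simp
      ring
    · rw [if_neg (by omega), if_neg (by omega)]
      simp

/-- The specialization `a₀ ↦ x`, `a₁ ↦ y`, `aᵢ ↦ 0` for `i ≥ 2`, and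
`bₛ ↦ (-1) ^ s * x ^ (k - s) * y ^ s` for `s ≤ k`, `bₛ ↦ 0` for `s > k`. -/
noncomputable def TwoSeqRing.specialize (F : Type*) [Field F] (k : ℕ) :
    TwoSeqRing F →+* MvPolynomial (Fin 2) F :=
  (MvPolynomial.aeval (Sum.elim
    -- Written as coefficients, so that the image of `f` is visibly the linear series.
    (fun i => PowerSeries.coeff i (PowerSeries.C (MvPolynomial.X 0) +
      PowerSeries.X * PowerSeries.C (MvPolynomial.X 1)))
    (fun s => if s ≤ k then
      (-1) ^ s * MvPolynomial.X 0 ^ (k - s) * MvPolynomial.X 1 ^ s else 0)) :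
    TwoSeqRing F →ₐ[F] MvPolynomial (Fin 2) F)

theorem TwoSeqRing.contentIdeal_mul_le_comap_specialize (F : Type*) [Field F] (k : ℕ) :
    (genericF F * genericG F).contentIdeal ≤ Ideal.comap (TwoSeqRing.specialize F k)
      (Ideal.span {MvPolynomial.X 0 ^ (k + 1), MvPolynomial.X 1 ^ (k + 1)}) := by
  refine Ideal.span_le.2 ?_
  rintro _ ⟨n, rfl⟩
  rw [SetLike.mem_coe, Ideal.mem_comap, ← PowerSeries.coeff_map, map_mul]
  convert PowerSeries.coeff_linear_mul_alternating_mem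
    (MvPolynomial.X 0 : MvPolynomial (Fin 2) F) (MvPolynomial.X 1) k n using 3
  · ext1 i
    simp [genericF, TwoSeqRing.a, TwoSeqRing.specialize]
  · ext1 i
    simp [genericG, TwoSeqRing.b, TwoSeqRing.specialize]

theorem TwoSeqRing.specialize_a_zero (F : Type*) [Field F] (k : ℕ) :
    TwoSeqRing.specialize F k (TwoSeqRing.a F 0) = MvPolynomial.X 0 := by
  simp [TwoSeqRing.a, TwoSeqRing.specialize]

theorem TwoSeqRing.specialize_b_self (F : Type*) [Field F] (k : ℕ) :
    TwoSeqRing.specialize F k (TwoSeqRing.b F k) = (-1) ^ k * MvPolynomial.X 1 ^ k := by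
  simp [TwoSeqRing.b, TwoSeqRing.specialize]

theorem PowerSeries.coeff_mem_contentIdeal {R : Type*} [CommRing R] (h : PowerSeries R) (n : ℕ) :
    coeff n h ∈ h.contentIdeal :=
  Ideal.subset_span ⟨n, rfl⟩

theorem TwoSeqRing.a_pow_mul_b_notMem (F : Type*) [Field F] (k : ℕ) :
    TwoSeqRing.a F 0 ^ k * TwoSeqRing.b F k ∉ (genericF F * genericG F).contentIdeal := by
  intro hab
  have hmem := TwoSeqRing.contentIdeal_mul_le_comap_specialize F k hab
  rw [Ideal.mem_comap, map_mul, map_pow, TwoSeqRing.specialize_a_zero,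
    TwoSeqRing.specialize_b_self] at hmem
  refine MvPolynomial.X_pow_mul_X_pow_notMem (R := F) k ?_
  convert Ideal.mul_mem_left _ ((-1) ^ k) hmem using 1
  have hsq : ((-1) ^ k * (-1) ^ k : MvPolynomial (Fin 2) F) = 1 := by
    rw [← mul_pow, neg_one_mul, neg_neg, one_pow]
  linear_combination -(MvPolynomial.X 0 ^ k * MvPolynomial.X 1 ^ k) * hsq

theorem TwoSeqRing.a_pow_mul_b_mem (F : Type*) [Field F] (k : ℕ) :
    TwoSeqRing.a F 0 ^ k * TwoSeqRing.b F k ∈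
      (genericF F).contentIdeal ^ k * (genericG F).contentIdeal := by
  have ha := PowerSeries.coeff_mem_contentIdeal (genericF F) 0
  have hb := PowerSeries.coeff_mem_contentIdeal (genericG F) k
  rw [genericF, PowerSeries.coeff_mk] at ha
  rw [genericG, PowerSeries.coeff_mk] at hb
  exact Ideal.mul_mem_mul (Ideal.pow_mem_pow ha k) hb

theorem mainTheorem5 (F : Type*) [Field F] :
    ¬ IsNoetherianRing (TwoSeqRing F) ∧
    ¬ ∃ k : ℕ, 1 ≤ k ∧
      (genericF F).contentIdeal ^ k * (genericG F).contentIdeal =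
        (genericF F).contentIdeal ^ (k - 1) * (genericF F * genericG F).contentIdeal := by
  refine ⟨MvPolynomial.not_isNoetherianRing, ?_⟩
  rintro ⟨k, -, h⟩
  have hle : (genericF F).contentIdeal ^ k * (genericG F).contentIdeal ≤
      (genericF F * genericG F).contentIdeal := h.trans_le Ideal.mul_le_right
  exact TwoSeqRing.a_pow_mul_b_notMem F k (hle (TwoSeqRing.a_pow_mul_b_mem F k))
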